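/- Let $\mathbb{F}_q$ be a finite field with $q$ elements and $\mathbb{F}_q[t]$ the polynomial ring in one variable over it. A finite nonzero ring $R$ is called a Carmichael ring if it is not a field and $a^{|R|}=a$ for every $a\in R$; a polynomial $f\in\mathbb{F}_q[t]$ is called a Carmichael polynomial if the quotient ring $\mathbb{F}_q[t]/(f)$ is a Carmichael ring. (1) Let $u\in\mathbb{F}_q[t]$ be square-free, and let $g,h\in\mathbb{F}_q[t]$ satisfy $g\neq 0$ and $\gcd(g,h)=1$. Then there are infinitely many square-free monic polynomials $w\in\mathbb{F}_q[t]$ such that every monic irreducible factor of $w$ is congruent to $h$ modulo $g$ and $uw$ is a Carmichael polynomial. (2) Let $g,h\in\mathbb{F}_q[t]$ with $g\neq 0$, and assume that $\gcd(g,h)$ is either equal to $1$ or square-free. Then there are infinitely many monic Carmichael polynomials $f\in\mathbb{F}_q[t]$ with $f\equiv h \pmod g$. -/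

import Mathlib

open Polynomial

/-- A Carmichael ring: a finite nonzero ring `R` that is not a field and in which
`a ^ |R| = a` for every `a`. -/
structure IsCarmichaelRing (R : Type*) [Ring R] : Prop where
  finite : Finite R
  nontrivial : Nontrivial R
  not_isField : ¬ IsField R
  pow_card : ∀ a : R, a ^ Nat.card R = a

/-- An ideal `I` of `R` is a Carmichael ideal if `R ⧸ I` is a Carmichael ring. -/
def IsCarmichaelIdeal {R : Type*} [CommRing R] (I : Ideal R) : Prop :=
  IsCarmichaelRing (R ⧸ I)

/-- An element of `R` is a Carmichael element if the principal ideal it generates is a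
Carmichael ideal. -/
def IsCarmichaelElement {R : Type*} [CommRing R] (r : R) : Prop :=
  IsCarmichaelIdeal (Ideal.span {r})

/-- A Carmichael polynomial is a Carmichael element of the polynomial ring `F[X]`. -/
def IsCarmichaelPolynomial {F : Type*} [Field F] (f : F[X]) : Prop :=
  IsCarmichaelElement f

/-! A square-free, non-unit, reducible `f` is Carmichael as soon as `deg P ∣ deg f` for every prime
`P ∣ f` (Korselt): each residue field has `q ^ deg P` elements, so its Frobenius powers fix
everything. Given `u` of degree `d`, multiply it by suitable numbers of primes of two consecutive
degrees `a` and `a + 1`, all congruent to `h` modulo `g`, so that the total degree becomes `a (a +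
1) · 2 d!`. This is divisible by `a`, by `a + 1` and by every degree occurring in `u`. Part (2)
follows by dividing out the gcd `D`, choosing one prime `P` in the reduced class, and applying part
(1) to `u = D P` with primes congruent to 1.

This needs Dirichlet's theorem for every large degree, with more than linearly many primes. For a
nontrivial character the `L`-series is a polynomial `∏ (1 - α X)`, and its logarithmic derivative
turns weighted prime-power sums into `-∑ α ^ n`. It remains to show `|α| < q`; the Riemann
hypothesis for curves is not needed. Positivity of the prime count in the class of 1, together with
simultaneous recurrence of the powers `α ^ n`, suffices (`norm_lt_card_of_mem_lInvRoots`). -/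

/-! ### Euler products and prime-power sums over monic polynomials -/

section Counting

variable {F : Type*} [Field F] [Finite F]

theorem finite_setOf_monic_natDegree_eq (n : ℕ) : {f : F[X] | f.Monic ∧ f.natDegree = n}.Finite :=
  Set.finite_coe_iff.mp <|
    Finite.of_equiv _ ((monicEquivDegreeLT (R := F) n).trans (degreeLTEquiv F n).toEquiv).symm

/-- The monic polynomials of degree `n`. -/
noncomputable def monicsOfDegree (F : Type*) [Field F] [Finite F] (n : ℕ) : Finset F[X] :=
  (finite_setOf_monic_natDegree_eq (F := F) n).toFinset

theorem mem_monicsOfDegree {n : ℕ} {f : F[X]} :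
    f ∈ monicsOfDegree F n ↔ f.Monic ∧ f.natDegree = n := by
  simp [monicsOfDegree]

theorem card_monicsOfDegree (n : ℕ) : (monicsOfDegree F n).card = Nat.card F ^ n := by
  rw [monicsOfDegree, ← Nat.card_eq_card_finite_toFinset]
  refine (Nat.card_congr ((monicEquivDegreeLT (R := F) n).trans (degreeLTEquiv F n).toEquiv)).trans ?_
  rw [Nat.card_fun, Nat.card_fin]

theorem finite_setOf_monic_irreducible (n : ℕ) :
    {P : F[X] | P.Monic ∧ Irreducible P ∧ P.natDegree ≤ n}.Finite := by
  classical
  refine ((Finset.range (n + 1)).biUnion (monicsOfDegree F)).finite_toSet.subset ?_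
  rintro P ⟨h1, -, h3⟩
  simp only [Finset.coe_biUnion, Set.mem_iUnion]
  exact ⟨P.natDegree, by simpa [Nat.lt_succ_iff] using h3, by simp [mem_monicsOfDegree, h1]⟩

/-- The monic irreducible polynomials of degree at most `n`. -/
noncomputable def monicPrimesLE (F : Type*) [Field F] [Finite F] (n : ℕ) : Finset F[X] :=
  (finite_setOf_monic_irreducible (F := F) n).toFinset

theorem mem_monicPrimesLE {n : ℕ} {P : F[X]} :
    P ∈ monicPrimesLE F n ↔ P.Monic ∧ Irreducible P ∧ P.natDegree ≤ n := by
  simp [monicPrimesLE]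

/-- The monic irreducible polynomials whose degree divides `n`. -/
noncomputable def monicPrimesDvd (F : Type*) [Field F] [Finite F] (n : ℕ) : Finset F[X] :=
  {P ∈ monicPrimesLE F n | P.natDegree ∣ n}

/-- At `n = 0` the degree bound leaves the set empty although every degree divides 0, hence the
hypothesis. -/
theorem mem_monicPrimesDvd {n : ℕ} (hn : n ≠ 0) {P : F[X]} :
    P ∈ monicPrimesDvd F n ↔ P.Monic ∧ Irreducible P ∧ P.natDegree ∣ n := by
  simp only [monicPrimesDvd, Finset.mem_filter, mem_monicPrimesLE]
  exact ⟨fun h => ⟨h.1.1, h.1.2.1, h.2⟩,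
    fun h => ⟨⟨h.1, h.2.1, Nat.le_of_dvd (Nat.pos_of_ne_zero hn) h.2.2⟩, h.2.2⟩⟩

/-- The coefficients of the `L`-series of `ψ`. -/
noncomputable def monicSum (ψ : F[X] →* ℂ) (n : ℕ) : ℂ := ∑ f ∈ monicsOfDegree F n, ψ f

/-- The coefficients of the logarithmic derivative of the `L`-series of `ψ`: the sum of
`deg P * ψ (P ^ j)` over the prime powers `P ^ j` of degree `n`. -/
noncomputable def primePowerSum (ψ : F[X] →* ℂ) (n : ℕ) : ℂ :=
  ∑ P ∈ monicPrimesDvd F n, (P.natDegree : ℂ) * ψ P ^ (n / P.natDegree)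

theorem monicSum_zero (ψ : F[X] →* ℂ) : monicSum ψ 0 = 1 := by
  have : monicsOfDegree F 0 = {1} := by
    ext f
    rw [mem_monicsOfDegree, Finset.mem_singleton]
    exact ⟨fun h => eq_one_of_monic_natDegree_zero h.1 h.2, fun h => by simp [h, monic_one]⟩
  simp [monicSum, this]

theorem monicSum_one (n : ℕ) : monicSum (1 : F[X] →* ℂ) n = (Nat.card F : ℂ) ^ n := by
  simp [monicSum, card_monicsOfDegree]

-- This is `deg f = ∑ deg P · v_P(f)`. The multiplicity is counted through the degrees `k` of the
-- powers of `P` dividing `f`, so that the sum can later be regrouped by `k`.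
open Classical in
theorem sum_natDegree_mul_count {f : F[X]} (hf : f.Monic) :
    ∑ P ∈ monicPrimesLE F f.natDegree,
      P.natDegree * ((Finset.Icc 1 f.natDegree).filter
        (fun k => P.natDegree ∣ k ∧ P ^ (k / P.natDegree) ∣ f)).card = f.natDegree := by
  have hf0 : f ≠ 0 := hf.ne_zero
  have hcount : ∀ P ∈ monicPrimesLE F f.natDegree,
      ((Finset.Icc 1 f.natDegree).filter
        (fun k => P.natDegree ∣ k ∧ P ^ (k / P.natDegree) ∣ f)).card =
      (UniqueFactorizationMonoid.normalizedFactors f).count P := by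
    intro P hP
    obtain ⟨hPm, hPi, -⟩ := mem_monicPrimesLE.mp hP
    have hd : 0 < P.natDegree := hPi.natDegree_pos
    have hmul : ∀ j, P ^ j ∣ f ↔ j ≤ (UniqueFactorizationMonoid.normalizedFactors f).count P := by
      intro j
      rw [pow_dvd_iff_le_emultiplicity,
        UniqueFactorizationMonoid.emultiplicity_eq_count_normalizedFactors hPi hf0,
        hPm.normalize_eq_self]
      exact Nat.cast_le
    have hle : ∀ j, P ^ j ∣ f → j * P.natDegree ≤ f.natDegree := fun j hj => by
      simpa using natDegree_le_of_dvd hj hf0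
    have : (Finset.Icc 1 f.natDegree).filter
        (fun k => P.natDegree ∣ k ∧ P ^ (k / P.natDegree) ∣ f) =
        (Finset.Icc 1 ((UniqueFactorizationMonoid.normalizedFactors f).count P)).image
          (· * P.natDegree) := by
      ext k
      simp only [Finset.mem_filter, Finset.mem_Icc, Finset.mem_image, ← hmul]
      constructor
      · rintro ⟨⟨h1, h2⟩, ⟨j, rfl⟩, h4⟩
        rw [Nat.mul_div_cancel_left _ hd] at h4
        exact ⟨j, ⟨Nat.pos_of_mul_pos_left h1, h4⟩, mul_comm _ _⟩
      · rintro ⟨j, ⟨h1, h2⟩, rfl⟩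
        refine ⟨⟨Nat.mul_pos h1 hd, hle j h2⟩, Dvd.intro_left _ rfl, ?_⟩
        rwa [Nat.mul_div_cancel _ hd]
    rw [this, Finset.card_image_of_injective _ (mul_left_injective₀ hd.ne')]
    simp
  rw [Finset.sum_congr rfl fun P hP => by rw [hcount P hP]]
  have hprod : (UniqueFactorizationMonoid.normalizedFactors f).prod = f := by
    have := UniqueFactorizationMonoid.prod_normalizedFactors_eq hf0
    rwa [hf.normalize_eq_self] at this
  have hsub : (UniqueFactorizationMonoid.normalizedFactors f).toFinset ⊆
      monicPrimesLE F f.natDegree := by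
    intro P hP
    rw [Multiset.mem_toFinset] at hP
    have hi := UniqueFactorizationMonoid.irreducible_of_normalized_factor P hP
    refine mem_monicPrimesLE.mpr ⟨?_, hi, natDegree_le_of_dvd
      (UniqueFactorizationMonoid.dvd_of_mem_normalizedFactors hP) hf0⟩
    rw [← UniqueFactorizationMonoid.normalize_normalized_factor P hP]
    exact monic_normalize hi.ne_zero
  rw [← Finset.sum_subset hsub fun P _ hP => by
    rw [Multiset.mem_toFinset] at hP; rw [Multiset.count_eq_zero_of_notMem hP, mul_zero]]
  conv_rhs => rw [← hprod, natDegree_multiset_prod _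
    (UniqueFactorizationMonoid.zero_notMem_normalizedFactors f),
    Finset.sum_multiset_map_count]
  refine Finset.sum_congr rfl fun P _ => ?_
  rw [smul_eq_mul, mul_comm]

open Classical in
theorem sum_monicsOfDegree_filter_dvd (ψ : F[X] →* ℂ) {Q : F[X]} (hQ : Q.Monic) {n : ℕ}
    (hn : Q.natDegree ≤ n) :
    ∑ f ∈ monicsOfDegree F n with Q ∣ f, ψ f = ψ Q * monicSum ψ (n - Q.natDegree) := by
  rw [monicSum, Finset.mul_sum]
  symm
  refine Finset.sum_bij (fun f _ => Q * f) ?_ ?_ ?_ ?_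
  · intro f hf
    obtain ⟨h1, h2⟩ := mem_monicsOfDegree.mp hf
    rw [Finset.mem_filter, mem_monicsOfDegree, hQ.natDegree_mul h1, h2]
    exact ⟨⟨hQ.mul h1, by omega⟩, dvd_mul_right _ _⟩
  · intro a _ b _ h
    exact mul_left_cancel₀ hQ.ne_zero h
  · intro f hf
    rw [Finset.mem_filter, mem_monicsOfDegree] at hf
    obtain ⟨⟨h1, h2⟩, k, rfl⟩ := hf
    have hk : k.Monic := hQ.of_mul_monic_left h1
    refine ⟨k, mem_monicsOfDegree.mpr ⟨hk, ?_⟩, rfl⟩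
    rw [hQ.natDegree_mul hk] at h2
    omega
  · intro f _
    rw [map_mul]

theorem monicPrimesDvd_eq_filter {k n : ℕ} (hk : k ∈ Finset.Icc 1 n) :
    monicPrimesDvd F k = {P ∈ monicPrimesLE F n | P.natDegree ∣ k} := by
  rw [Finset.mem_Icc] at hk
  ext P
  rw [mem_monicPrimesDvd (by omega), Finset.mem_filter, mem_monicPrimesLE]
  exact ⟨fun h => ⟨⟨h.1, h.2.1, (Nat.le_of_dvd (by omega) h.2.2).trans hk.2⟩, h.2.2⟩,
    fun h => ⟨h.1.1, h.1.2.1, h.2⟩⟩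

open Classical in
/-- The logarithmic derivative of the Euler product, coefficientwise. -/
theorem natCast_mul_monicSum (ψ : F[X] →* ℂ) (n : ℕ) :
    n * monicSum ψ n = ∑ k ∈ Finset.Icc 1 n, primePowerSum ψ k * monicSum ψ (n - k) := by
  have h1 : n * monicSum ψ n = ∑ f ∈ monicsOfDegree F n, ∑ P ∈ monicPrimesLE F n,
      ∑ k ∈ Finset.Icc 1 n,
        if P.natDegree ∣ k ∧ P ^ (k / P.natDegree) ∣ f then (P.natDegree : ℂ) * ψ f else 0 := by
    rw [monicSum, Finset.mul_sum]
    refine Finset.sum_congr rfl fun f hf => ?_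
    obtain ⟨hm, rfl⟩ := mem_monicsOfDegree.mp hf
    conv_lhs => rw [← sum_natDegree_mul_count hm]
    push_cast
    rw [Finset.sum_mul]
    refine Finset.sum_congr rfl fun P _ => ?_
    rw [← Finset.sum_filter, Finset.sum_const, nsmul_eq_mul]
    ring
  rw [h1, Finset.sum_comm, Finset.sum_congr rfl fun P _ => Finset.sum_comm, Finset.sum_comm]
  refine Finset.sum_congr rfl fun k hk => ?_
  rw [primePowerSum, monicPrimesDvd_eq_filter hk, Finset.sum_mul, Finset.sum_filter]
  refine Finset.sum_congr rfl fun P hP => ?_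
  split_ifs with hd
  · obtain ⟨hPm, hPi, -⟩ := mem_monicPrimesLE.mp hP
    have hdeg : (P ^ (k / P.natDegree)).natDegree = k := by
      rw [natDegree_pow, Nat.div_mul_cancel hd]
    simp only [hd, true_and]
    rw [← Finset.sum_filter, ← Finset.mul_sum, sum_monicsOfDegree_filter_dvd ψ (hPm.pow _)
      (hdeg.trans_le (Finset.mem_Icc.mp hk).2), hdeg, map_pow]
    ring
  · simp [hd]

/-- The recurrence determines the coefficients of the logarithmic derivative. -/
theorem eq_of_logDeriv_recurrence {s a b : ℕ → ℂ} (hs : s 0 = 1)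
    (ha : ∀ n : ℕ, n * s n = ∑ k ∈ Finset.Icc 1 n, a k * s (n - k))
    (hb : ∀ n : ℕ, n * s n = ∑ k ∈ Finset.Icc 1 n, b k * s (n - k)) {n : ℕ} (hn : n ≠ 0) :
    a n = b n := by
  induction n using Nat.strong_induction_on with
  | _ n ih =>
    obtain ⟨m, rfl⟩ := Nat.exists_eq_succ_of_ne_zero hn
    have h := (ha (m + 1)).symm.trans (hb (m + 1))
    rw [Finset.sum_Icc_succ_top (by omega), Finset.sum_Icc_succ_top (by omega),
      Finset.sum_congr rfl fun k hk => by
        rw [ih k (by rw [Finset.mem_Icc] at hk; omega) (by rw [Finset.mem_Icc] at hk; omega)]] at h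
    simpa [hs] using h

/-- For the zeta function the coefficients are `q ^ n`, and `q ^ k * q ^ (n - k) = q ^ n` shows that
`q ^ n` also solves the recurrence. -/
theorem primePowerSum_one {n : ℕ} (hn : n ≠ 0) :
    primePowerSum (1 : F[X] →* ℂ) n = (Nat.card F : ℂ) ^ n := by
  refine eq_of_logDeriv_recurrence (monicSum_zero 1) (natCast_mul_monicSum 1)
    (b := fun n => (Nat.card F : ℂ) ^ n) (fun m => ?_) hn
  rw [Finset.sum_congr rfl fun k hk => show _ = (Nat.card F : ℂ) ^ m by
    rw [monicSum_one, ← pow_add, Nat.add_sub_cancel' (Finset.mem_Icc.mp hk).2]]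
  simp [monicSum_one]

theorem sum_natDegree_monicPrimesDvd {n : ℕ} (hn : n ≠ 0) :
    ∑ P ∈ monicPrimesDvd F n, P.natDegree = Nat.card F ^ n := by
  have := primePowerSum_one (F := F) hn
  simp only [primePowerSum, MonoidHom.one_apply, one_pow, mul_one] at this
  exact_mod_cast this

end Counting

/-! ### Newton's identities and recurrence of powers of complex numbers -/

section PowerSums

theorem eq_prod_one_sub_inv_roots {L : ℂ[X]} (hL : L.coeff 0 = 1) :
    L = ((L.roots.map (·⁻¹)).map fun α => 1 - C α * X).prod := by
  have hL0 : L ≠ 0 := by rintro rfl; simp at hL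
  have hs := (IsAlgClosed.splits L).eq_prod_roots
  have hroot : ∀ β ∈ L.roots, β ≠ 0 := by
    rintro β hβ rfl
    have := (mem_roots'.mp hβ).2
    rw [IsRoot, ← coeff_zero_eq_eval_zero, hL] at this
    exact one_ne_zero this
  have key : (L.roots.map (X - C ·)).prod =
      C (L.roots.map (-·)).prod * ((L.roots.map (·⁻¹)).map fun α => 1 - C α * X).prod := by
    rw [map_multiset_prod, Multiset.map_map, Multiset.map_map, ← Multiset.prod_map_mul]
    refine congrArg Multiset.prod (Multiset.map_congr rfl fun β hβ => ?_)
    have : C β * C β⁻¹ = (1 : ℂ[X]) := by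
      rw [← C_mul, mul_inv_cancel₀ (hroot β hβ), C_1]
    simp only [Function.comp, C_neg]
    linear_combination (-X) * this
  rw [key, ← mul_assoc, ← C_mul] at hs
  have h0 := congrArg (fun p => p.coeff 0) hs
  simp only [mul_coeff_zero, coeff_C_zero, hL, coeff_zero_multiset_prod, Multiset.map_map] at h0
  have h1 : (L.roots.map ((fun p : ℂ[X] => p.coeff 0) ∘
      ((fun α => 1 - C α * X) ∘ (·⁻¹)))).prod = 1 := by
    refine Multiset.prod_eq_one fun x hx => ?_
    obtain ⟨β, -, rfl⟩ := Multiset.mem_map.mp hx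
    simp
  rw [h1, mul_one] at h0
  rwa [← h0, C_1, one_mul] at hs

/-- Logarithmic differentiation: each factor contributes `-αX / (1 - αX)`, minus a geometric series
starting at degree 1. Clearing denominators keeps everything in power series. -/
theorem X_mul_derivative_prod_one_sub (A : Multiset ℂ) :
    ((X * derivative (A.map fun α => 1 - C α * X).prod : ℂ[X]) : PowerSeries ℂ) =
      -((A.map fun α => PowerSeries.mk fun n => if n = 0 then 0 else α ^ n).sum *
        ((A.map fun α => 1 - C α * X).prod : ℂ[X])) := by
  induction A using Multiset.induction with
  | empty => simp
  | cons α A ih =>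
    have hE : ((1 - C α * X : ℂ[X]) : PowerSeries ℂ) *
        (PowerSeries.mk fun n => if n = 0 then 0 else α ^ n) = ((C α * X : ℂ[X]) : PowerSeries ℂ) := by
      ext n
      rw [Polynomial.coe_sub, sub_mul, map_sub]
      simp only [coe_one, one_mul, coe_mul, coe_C, coe_X, mul_assoc, PowerSeries.coeff_C_mul,
        PowerSeries.coeff_mk]
      rcases n with _ | n
      · simp
      · rw [PowerSeries.coeff_succ_X_mul, PowerSeries.coeff_X, PowerSeries.coeff_mk]
        rcases n with _ | n
        · simp
        · simp [pow_succ']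
    rw [Multiset.map_cons, Multiset.prod_cons, Multiset.map_cons, Multiset.sum_cons]
    set L := (A.map fun α => 1 - C α * X).prod
    set P := (A.map fun α => PowerSeries.mk fun n => if n = 0 then 0 else α ^ n).sum
    set E := PowerSeries.mk fun n => if n = 0 then 0 else α ^ n
    have hd : X * derivative ((1 - C α * X) * L) =
        -(C α * X) * L + (1 - C α * X) * (X * derivative L) := by
      simp only [derivative_mul, derivative_sub, derivative_one, derivative_C, derivative_X]
      ring
    rw [hd, coe_add, coe_mul _ (X * _), ih, coe_mul, coe_mul, coe_neg, ← hE]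
    ring

theorem logDeriv_recurrence_prod_one_sub (A : Multiset ℂ) (n : ℕ) :
    n * (A.map fun α => 1 - C α * X).prod.coeff n = ∑ k ∈ Finset.Icc 1 n,
      -(A.map (· ^ k)).sum * (A.map fun α => 1 - C α * X).prod.coeff (n - k) := by
  have h := congrArg (PowerSeries.coeff n) (X_mul_derivative_prod_one_sub A)
  have hP : ∀ k, PowerSeries.coeff k
      (A.map fun α => PowerSeries.mk fun n => if n = 0 then 0 else α ^ n).sum =
      if k = 0 then 0 else (A.map (· ^ k)).sum := by
    intro k
    rw [map_multiset_sum, Multiset.map_map]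
    simp only [Function.comp_def, PowerSeries.coeff_mk]
    split_ifs <;> simp
  have hl : ∀ L : ℂ[X], (X * derivative L).coeff n = n * L.coeff n := by
    intro L
    rcases n with _ | n
    · simp
    · rw [coeff_X_mul, coeff_derivative]; push_cast; ring
  rw [coeff_coe, hl, map_neg, PowerSeries.coeff_mul,
    Finset.Nat.sum_antidiagonal_eq_sum_range_succ_mk, Finset.range_eq_Ico,
    Finset.sum_eq_sum_Ico_succ_bot (by omega)] at h
  simp only [hP, coeff_coe, if_true, zero_mul, zero_add] at h
  rw [h, ← Finset.sum_neg_distrib]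
  refine Finset.sum_congr (by ext; simp) fun k hk => ?_
  rw [if_neg (by rw [Finset.mem_Icc] at hk; omega)]
  ring

/-- Simultaneous recurrence of the arguments of the powers of finitely many complex numbers. -/
theorem exists_pow_re_ge (A : Multiset ℂ) (N : ℕ) :
    ∃ n ≥ N, ∀ α ∈ A, 3 / 4 * ‖α‖ ^ n ≤ (α ^ n).re := by
  classical
  let x : A.toFinset → Circle := fun i => Circle.exp (Complex.arg i)
  -- The phases form a point of a compact torus, whose powers return to every neighbourhood of 1.
  have hU : {y : A.toFinset → Circle | ∀ i, 3 / 4 < (y i : ℂ).re} ∈ nhds 1 := by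
    refine IsOpen.mem_nhds ?_ fun i => by norm_num
    rw [Set.ofPred_forall]
    exact isOpen_iInter_of_finite fun i => isOpen_lt continuous_const (by fun_prop)
  obtain ⟨n, hn, h⟩ := ((mapClusterPt_one_atTop_pow x).frequently hU).forall_exists_of_atTop N
  refine ⟨n, hn, fun α hα => ?_⟩
  have h1 : 3 / 4 < ((x ⟨α, by simpa using hα⟩ : ℂ) ^ n).re := by
    simpa using h ⟨α, by simpa using hα⟩
  have h2 : α ^ n = ((‖α‖ ^ n : ℝ) : ℂ) * (x ⟨α, by simpa using hα⟩ : ℂ) ^ n := by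
    conv_lhs => rw [← Complex.norm_mul_exp_arg_mul_I α]
    rw [mul_pow]; push_cast; rfl
  rw [h2, Complex.re_ofReal_mul, mul_comm]
  exact mul_le_mul_of_nonneg_left h1.le (by positivity)

end PowerSums

/-! ### L-polynomials and their inverse zeros -/

section LPolynomial

variable {F : Type*} [Field F] [Finite F]

/-- The `L`-series of `ψ`, truncated at degree `m`. -/
noncomputable def lPolynomial (ψ : F[X] →* ℂ) (m : ℕ) : ℂ[X] :=
  ∑ k ∈ Finset.range m, monomial k (monicSum ψ k)

/-- The inverses of the zeros of the `L`-polynomial. -/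
noncomputable def lInvRoots (ψ : F[X] →* ℂ) (m : ℕ) : Multiset ℂ :=
  (lPolynomial ψ m).roots.map (·⁻¹)

theorem coeff_lPolynomial {ψ : F[X] →* ℂ} {m : ℕ} (hm : ∀ n ≥ m, monicSum ψ n = 0) (n : ℕ) :
    (lPolynomial ψ m).coeff n = monicSum ψ n := by
  simp only [lPolynomial, finsetSum_coeff, coeff_monomial, Finset.sum_ite_eq', Finset.mem_range]
  split_ifs with h
  · rfl
  · exact (hm n (not_lt.mp h)).symm

theorem primePowerSum_eq_neg_sum_lInvRoots {ψ : F[X] →* ℂ} {m : ℕ}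
    (hm : ∀ n ≥ m, monicSum ψ n = 0) {n : ℕ} (hn : n ≠ 0) :
    primePowerSum ψ n = -((lInvRoots ψ m).map (· ^ n)).sum := by
  have hL : _ = ((lInvRoots ψ m).map _).prod := eq_prod_one_sub_inv_roots (L := lPolynomial ψ m)
    (by rw [coeff_lPolynomial hm, monicSum_zero])
  refine eq_of_logDeriv_recurrence (b := fun n => -((lInvRoots ψ m).map (· ^ n)).sum)
    (monicSum_zero ψ) (natCast_mul_monicSum ψ) (fun n => ?_) hn
  have := logDeriv_recurrence_prod_one_sub (lInvRoots ψ m) n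
  rw [← hL] at this
  simpa only [coeff_lPolynomial hm] using this

theorem conj_mem_lInvRoots {ψ ψ' : F[X] →* ℂ} (h : ∀ f, ψ' f = starRingEnd ℂ (ψ f)) {m : ℕ}
    {α : ℂ} (hα : α ∈ lInvRoots ψ m) : starRingEnd ℂ α ∈ lInvRoots ψ' m := by
  have hL : lPolynomial ψ' m = (lPolynomial ψ m).map (starRingEnd ℂ) := by
    simp [lPolynomial, Polynomial.map_sum, monicSum, h]
  obtain ⟨β, hβ, rfl⟩ := Multiset.mem_map.mp hα
  refine Multiset.mem_map.mpr ⟨starRingEnd ℂ β, ?_, by simp⟩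
  rw [mem_roots'] at hβ ⊢
  rw [hL, IsRoot, eval_map_apply, hβ.2, map_zero]
  exact ⟨(Polynomial.map_ne_zero_iff (starRingEnd ℂ).injective).mpr hβ.1, rfl⟩

end LPolynomial

/-! ### Characters modulo `g` and the bound for the inverse zeros -/

section Characters

variable {F : Type*} [Field F] {g : F[X]}

/-- A character modulo `g`, as a function on polynomials. -/
noncomputable def modChar (χ : MulChar (AdjoinRoot g) ℂ) : F[X] →* ℂ :=
  χ.toMonoidHom.comp (AdjoinRoot.mk g : F[X] →* AdjoinRoot g)

theorem modChar_apply (χ : MulChar (AdjoinRoot g) ℂ) (f : F[X]) :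
    modChar χ f = χ (AdjoinRoot.mk g f) := rfl

theorem isUnit_mk_iff {f : F[X]} : IsUnit (AdjoinRoot.mk g f) ↔ IsCoprime g f := by
  constructor
  · intro h
    obtain ⟨b, hb⟩ := h.exists_right_inv
    obtain ⟨b, rfl⟩ := AdjoinRoot.mk_surjective b
    rw [← map_mul, ← map_one (AdjoinRoot.mk g), AdjoinRoot.mk_eq_mk] at hb
    obtain ⟨k, hk⟩ := hb
    exact ⟨-k, b, by linear_combination hk⟩
  · rintro ⟨a, b, hab⟩
    refine IsUnit.of_mul_eq_one (AdjoinRoot.mk g b) ?_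
    rw [← map_mul, ← map_one (AdjoinRoot.mk g), AdjoinRoot.mk_eq_mk]
    exact ⟨-a, by linear_combination hab⟩

variable [Finite F]

theorem finite_adjoinRoot_of_ne_zero (hg : g ≠ 0) : Finite (AdjoinRoot g) :=
  have : Module.Finite F (AdjoinRoot g) := (AdjoinRoot.powerBasis hg).finite
  Module.finite_of_finite F

/-- In degree `n ≥ deg g`, adding a reduced residue permutes the monic polynomials. Averaging over
all residues therefore leaves the sum unchanged, while orthogonality makes it vanish. -/
theorem monicSum_modChar_eq_zero (hg : g ≠ 0) {χ : MulChar (AdjoinRoot g) ℂ} (hχ : χ ≠ 1) {n : ℕ}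
    (hn : g.natDegree ≤ n) : monicSum (modChar χ) n = 0 := by
  have := finite_adjoinRoot_of_ne_zero hg
  have := Fintype.ofFinite (AdjoinRoot g)
  have hshift : ∀ r : AdjoinRoot g,
      ∑ f ∈ monicsOfDegree F n, χ (AdjoinRoot.mk g f + r) = monicSum (modChar χ) n := by
    intro r
    obtain ⟨p, rfl⟩ := AdjoinRoot.mk_surjective r
    have hp : (p % g).degree < n := (EuclideanDomain.mod_lt p hg).trans_le
      (degree_le_natDegree.trans (by exact_mod_cast hn))
    have hmk : AdjoinRoot.mk g p = AdjoinRoot.mk g (p % g) := by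
      rw [AdjoinRoot.mk_eq_mk]
      exact ⟨p / g, by linear_combination -(EuclideanDomain.div_add_mod p g)⟩
    have hmem : ∀ s : F[X], s.degree < n → ∀ f ∈ monicsOfDegree F n,
        f + s ∈ monicsOfDegree F n := by
      intro s hs f hf
      obtain ⟨h1, h2⟩ := mem_monicsOfDegree.mp hf
      have hlt : s.degree < f.degree := by rwa [degree_eq_natDegree h1.ne_zero, h2]
      exact mem_monicsOfDegree.mpr ⟨h1.add_of_left hlt,
        by rw [natDegree_add_eq_left_of_degree_lt hlt, h2]⟩
    rw [monicSum]
    refine Finset.sum_nbij' (· + p % g) (· - p % g) (hmem _ hp) ?_ (fun _ _ => add_sub_cancel_right _ _)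
      (fun _ _ => sub_add_cancel _ _) fun f _ => by rw [modChar_apply, map_add (AdjoinRoot.mk g), hmk]
    intro f hf
    rw [sub_eq_add_neg]
    exact hmem _ (by rwa [degree_neg]) f hf
  have h0 : ∑ r : AdjoinRoot g, ∑ f ∈ monicsOfDegree F n, χ (AdjoinRoot.mk g f + r) = 0 := by
    rw [Finset.sum_comm]
    refine Finset.sum_eq_zero fun f _ => ?_
    rw [← MulChar.sum_eq_zero_of_ne_one hχ]
    exact Equiv.sum_comp (Equiv.addLeft (AdjoinRoot.mk g f)) (fun r => χ r)
  simp only [hshift, Finset.sum_const, nsmul_eq_mul] at h0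
  have : Nonempty (AdjoinRoot g) := ⟨0⟩
  exact (mul_eq_zero.mp h0).resolve_left (by simp [Fintype.card_ne_zero])

/-- The sum of `deg P` over the prime powers `P ^ j` of degree `n` with `P` not dividing `g`. -/
noncomputable def coprimePrimePowerSum (g : F[X]) (n : ℕ) : ℕ :=
  open Classical in ∑ P ∈ monicPrimesDvd F n with ¬ P ∣ g, P.natDegree

/-- The sum of `deg P` over the prime powers `P ^ j` of degree `n` congruent to `h` modulo `g`. -/
noncomputable def progressionPrimePowerSum (g h : F[X]) (n : ℕ) : ℕ :=
  open Classical in ∑ P ∈ monicPrimesDvd F n with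
    AdjoinRoot.mk g P ^ (n / P.natDegree) = AdjoinRoot.mk g h, P.natDegree

theorem primePowerSum_modChar_one {n : ℕ} (hn : n ≠ 0) :
    primePowerSum (modChar (1 : MulChar (AdjoinRoot g) ℂ)) n = coprimePrimePowerSum g n := by
  classical
  rw [primePowerSum, coprimePrimePowerSum, Nat.cast_sum, Finset.sum_filter]
  refine Finset.sum_congr rfl fun P hP => ?_
  obtain ⟨hPm, hPi, hPd⟩ := (mem_monicPrimesDvd hn).mp hP
  have hpos : n / P.natDegree ≠ 0 :=
    (Nat.div_pos (Nat.le_of_dvd (Nat.pos_of_ne_zero hn) hPd) hPi.natDegree_pos).ne'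
  have hu : IsUnit (AdjoinRoot.mk g P) ↔ ¬ P ∣ g := by
    rw [isUnit_mk_iff, isCoprime_comm, (Irreducible.coprime_iff_not_dvd hPi)]
  rw [modChar_apply]
  by_cases h : P ∣ g
  · rw [MulChar.map_nonunit _ (hu.not.mpr (not_not.mpr h)), zero_pow hpos, mul_zero, if_neg (not_not.mpr h)]
  · rw [MulChar.one_apply (hu.mpr h), one_pow, mul_one, if_pos h]

theorem coprimePrimePowerSum_le {n : ℕ} (hn : n ≠ 0) :
    coprimePrimePowerSum g n ≤ Nat.card F ^ n := by
  classical
  rw [← sum_natDegree_monicPrimesDvd hn]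
  exact Finset.sum_le_sum_of_subset (Finset.filter_subset _ _)

theorem exists_le_coprimePrimePowerSum_add (hg : g ≠ 0) :
    ∃ K, ∀ n, n ≠ 0 → Nat.card F ^ n ≤ coprimePrimePowerSum g n + K := by
  classical
  refine ⟨∑ P ∈ monicPrimesLE F g.natDegree, P.natDegree, fun n hn => ?_⟩
  rw [← sum_natDegree_monicPrimesDvd hn, coprimePrimePowerSum,
    ← Finset.sum_filter_not_add_sum_filter _ (fun P => P ∣ g)]
  refine Nat.add_le_add_left (Finset.sum_le_sum_of_subset fun P hP => ?_) _
  obtain ⟨h1, h2⟩ := Finset.mem_filter.mp hP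
  obtain ⟨h3, h4, -⟩ := (mem_monicPrimesDvd hn).mp h1
  exact mem_monicPrimesLE.mpr ⟨h3, h4, natDegree_le_of_dvd h2 hg⟩

theorem MulChar.sum_inv_apply_mul_apply {R : Type*} [CommRing R] [Finite R]
    [Fintype (MulChar R ℂ)] {a : R} (ha : IsUnit a) (b : R) [Decidable (b = a)] :
    ∑ χ : MulChar R ℂ, χ⁻¹ a * χ b = if b = a then (Fintype.card (MulChar R ℂ) : ℂ) else 0 := by
  obtain ⟨u, rfl⟩ := ha
  have h1 : ∀ χ : MulChar R ℂ, χ⁻¹ (u : R) * χ b = χ (↑u⁻¹ * b) := fun χ => by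
    rw [MulChar.inv_apply, Ring.inverse_unit, map_mul]
  simp only [h1]
  split_ifs with h
  · simp [h]
  · have hne : (↑u⁻¹ * b : R) ≠ 1 := fun h' => h (by rwa [Units.inv_mul_eq_one, eq_comm] at h')
    obtain ⟨χ, hχ⟩ := MulChar.exists_apply_ne_one_of_hasEnoughRootsOfUnity R ℂ hne
    refine eq_zero_of_mul_eq_self_left hχ ?_
    simp only [Finset.mul_sum, ← MulChar.mul_apply]
    exact Fintype.sum_bijective _ (Group.mulLeft_bijective χ) _ _ fun χ' => rfl

theorem card_mul_progressionPrimePowerSum (hg : g ≠ 0) [Fintype (MulChar (AdjoinRoot g) ℂ)]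
    {h : F[X]} (hh : IsCoprime g h) (n : ℕ) :
    (Fintype.card (MulChar (AdjoinRoot g) ℂ) : ℂ) * progressionPrimePowerSum g h n =
      ∑ χ : MulChar (AdjoinRoot g) ℂ, χ⁻¹ (AdjoinRoot.mk g h) * primePowerSum (modChar χ) n := by
  classical
  have := finite_adjoinRoot_of_ne_zero hg
  simp only [primePowerSum, Finset.mul_sum]
  rw [Finset.sum_comm, progressionPrimePowerSum, Nat.cast_sum, Finset.sum_filter, Finset.mul_sum]
  refine Finset.sum_congr rfl fun P _ => ?_
  have := MulChar.sum_inv_apply_mul_apply (isUnit_mk_iff.mpr hh)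
    (AdjoinRoot.mk g P ^ (n / P.natDegree))
  simp only [map_pow] at this
  simp only [modChar_apply, mul_left_comm _ (P.natDegree : ℂ), ← Finset.mul_sum, this]
  split_ifs <;> ring

/-- The inverse zeros of the `L`-functions modulo `g` lie strictly inside the circle of
radius `q`. -/
theorem norm_lt_card_of_mem_lInvRoots (hg : g ≠ 0) {χ : MulChar (AdjoinRoot g) ℂ} (hχ : χ ≠ 1)
    {α : ℂ} (hα : α ∈ lInvRoots (modChar χ) g.natDegree) : ‖α‖ < Nat.card F := by
  classical
  have := finite_adjoinRoot_of_ne_zero hg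
  have := Fintype.ofFinite (MulChar (AdjoinRoot g) ℂ)
  set q := Nat.card F with hq
  have hq1 : 1 < q := Finite.one_lt_card
  -- All nontrivial characters are pooled, because the positivity used below concerns their sum; the
  -- pool is closed under conjugation since `χ⁻¹` is the conjugate of `χ`.
  set B : Multiset ℂ := ∑ χ ∈ Finset.univ.erase (1 : MulChar (AdjoinRoot g) ℂ),
    lInvRoots (modChar χ) g.natDegree with hB
  have memB : ∀ β, β ∈ B ↔ ∃ χ : MulChar (AdjoinRoot g) ℂ, χ ≠ 1 ∧
      β ∈ lInvRoots (modChar χ) g.natDegree := by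
    intro β
    simp [hB, Multiset.mem_sum]
  have conjB : ∀ β ∈ B, starRingEnd ℂ β ∈ B := by
    intro β hβ
    obtain ⟨χ, h1, h2⟩ := (memB β).mp hβ
    refine (memB _).mpr ⟨χ⁻¹, inv_ne_one.mpr h1, conj_mem_lInvRoots (fun f => ?_) h2⟩
    rw [modChar_apply, modChar_apply, ← MulChar.star_apply' χ]
    rfl
  have hsum : ∀ n, n ≠ 0 → (Fintype.card (MulChar (AdjoinRoot g) ℂ) : ℝ) *
      progressionPrimePowerSum g 1 n + (B.map fun β => (β ^ n).re).sum =
      coprimePrimePowerSum g n := by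
    intro n hn
    have h := card_mul_progressionPrimePowerSum hg (isCoprime_one_right (x := g)) n
    rw [← Finset.add_sum_erase _ _ (Finset.mem_univ 1), primePowerSum_modChar_one hn] at h
    simp only [map_one, one_mul, inv_one] at h
    have h2 : ∑ χ ∈ Finset.univ.erase (1 : MulChar (AdjoinRoot g) ℂ), primePowerSum (modChar χ) n =
        -(B.map (· ^ n)).sum := by
      rw [hB, ← Multiset.coe_mapAddMonoidHom, map_sum, ← Multiset.coe_sumAddMonoidHom, map_sum,
        ← Finset.sum_neg_distrib]
      exact Finset.sum_congr rfl fun χ hχ => primePowerSum_eq_neg_sum_lInvRoots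
        (fun k hk => monicSum_modChar_eq_zero hg (Finset.ne_of_mem_erase hχ) hk) hn
    rw [h2] at h
    have h3 := congrArg Complex.reLm h
    rw [map_add, map_neg, map_multiset_sum, Multiset.map_map] at h3
    simp only [Function.comp_def, Complex.reLm_coe, ← Nat.cast_mul, Complex.natCast_re] at h3
    push_cast at h3
    linarith
  obtain ⟨K, hK⟩ := exists_le_coprimePrimePowerSum_add hg
  set Φ := Nat.card (AdjoinRoot g)ˣ with hΦ
  have hΦ0 : 0 < Φ := Nat.card_pos
  -- With `n = 2Φj`, every prime to `g` of degree dividing `j` has a power of degree `n` congruent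
  -- to 1. As `q ^ j > j > K`, such primes exist. The factor 2 makes `n` even.
  obtain ⟨j, hj, hrec⟩ := exists_pow_re_ge (B.map (· ^ (2 * Φ))) (K + 1)
  have hj0 : j ≠ 0 := by omega
  set n := 2 * Φ * j with hn
  have hn0 : n ≠ 0 := by positivity
  replace hrec : ∀ β ∈ B, 3 / 4 * ‖β‖ ^ n ≤ (β ^ n).re := by
    intro β hβ
    have := hrec _ (Multiset.mem_map_of_mem _ hβ)
    rwa [← pow_mul, norm_pow, ← pow_mul] at this
  have hpos : 0 < progressionPrimePowerSum g 1 n := by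
    refine lt_of_lt_of_le (b := coprimePrimePowerSum g j) ?_ ?_
    · have h1 : q ^ j ≤ _ := hK j hj0
      have := j.lt_pow_self hq1
      omega
    · refine Finset.sum_le_sum_of_subset fun P hP => ?_
      obtain ⟨h1, h2⟩ := Finset.mem_filter.mp hP
      obtain ⟨h3, h4, h5⟩ := (mem_monicPrimesDvd hj0).mp h1
      refine Finset.mem_filter.mpr ⟨(mem_monicPrimesDvd hn0).mpr ⟨h3, h4, h5.mul_left _⟩, ?_⟩
      obtain ⟨u, hu⟩ := isUnit_mk_iff.mpr
        ((Irreducible.coprime_iff_not_dvd h4).mpr h2).symm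
      rw [Nat.mul_div_assoc _ h5, ← hu, ← Units.val_pow_eq_pow_val, mul_comm 2, mul_assoc, pow_mul,
        hΦ, pow_card_eq_one', one_pow, map_one, Units.val_one]
  have hlt : (B.map fun β => (β ^ n).re).sum < (q : ℝ) ^ n := by
    have h1 := hsum n hn0
    have h2 : (coprimePrimePowerSum g n : ℝ) ≤ (q : ℝ) ^ n := by
      exact_mod_cast coprimePrimePowerSum_le hn0
    have h3 : (0 : ℝ) < Fintype.card (MulChar (AdjoinRoot g) ℂ) * progressionPrimePowerSum g 1 n := by
      have : 0 < Fintype.card (MulChar (AdjoinRoot g) ℂ) := Fintype.card_pos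
      positivity
    linarith
  have hnonneg : ∀ β ∈ B, 0 ≤ (β ^ n).re := fun β hβ => le_trans (by positivity) (hrec β hβ)
  by_contra! hle
  have hαB : α ∈ B := (memB α).mpr ⟨χ, hχ, hα⟩
  have hqα : (q : ℝ) ^ n ≤ ‖α‖ ^ n := pow_le_pow_left₀ (Nat.cast_nonneg _) hle n
  obtain ⟨B', hB'⟩ := Multiset.exists_cons_of_mem hαB
  rw [hB', Multiset.map_cons, Multiset.sum_cons] at hlt
  -- If `|α| ≥ q`, the real parts sum to at least `q ^ n`, a contradiction. A real `α` gives this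
  -- alone because `n` is even; a nonreal one comes with its conjugate, and `3/4 + 3/4 > 1`.
  by_cases hreal : starRingEnd ℂ α = α
  · have h1 : (α ^ n).re = ‖α‖ ^ n := by
      obtain ⟨r, rfl⟩ := Complex.conj_eq_iff_real.mp hreal
      rw [← Complex.ofReal_pow, Complex.ofReal_re, Complex.norm_real, Real.norm_eq_abs,
        Even.pow_abs ⟨Φ * j, by rw [hn]; ring⟩]
    have h2 : 0 ≤ (B'.map fun β => (β ^ n).re).sum := Multiset.sum_nonneg fun x hx => by
      obtain ⟨β, hβ, rfl⟩ := Multiset.mem_map.mp hx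
      exact hnonneg β (hB' ▸ Multiset.mem_cons_of_mem hβ)
    linarith
  · have hc : starRingEnd ℂ α ∈ B' := by
      have := conjB α hαB
      rw [hB', Multiset.mem_cons] at this
      exact this.resolve_left hreal
    obtain ⟨B'', hB''⟩ := Multiset.exists_cons_of_mem hc
    rw [hB'', Multiset.map_cons, Multiset.sum_cons] at hlt
    have h1 := hrec α hαB
    have h2 := hrec _ (conjB α hαB)
    rw [RCLike.norm_conj] at h2
    have h3 : 0 ≤ (B''.map fun β => (β ^ n).re).sum := Multiset.sum_nonneg fun x hx => by
      obtain ⟨β, hβ, rfl⟩ := Multiset.mem_map.mp hx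
      exact hnonneg β (hB' ▸ Multiset.mem_cons_of_mem (hB'' ▸ Multiset.mem_cons_of_mem hβ))
    have h4 : (0 : ℝ) < (q : ℝ) ^ n := by positivity
    linarith

end Characters

/-! ### Dirichlet's theorem with prescribed degree -/

section Progressions

open Filter Topology

variable {F : Type*} [Field F] [Finite F] {g h : F[X]}

theorem tendsto_primePowerSum_div (hg : g ≠ 0) (χ : MulChar (AdjoinRoot g) ℂ)
    [Decidable (χ = 1)] :
    Tendsto (fun n : ℕ => primePowerSum (modChar χ) n / (Nat.card F : ℂ) ^ n) atTop
      (𝓝 (if χ = 1 then 1 else 0)) := by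
  have hq1 : (1 : ℝ) < Nat.card F := by exact_mod_cast (Finite.one_lt_card : 1 < Nat.card F)
  have hq0 : (Nat.card F : ℂ) ≠ 0 := by exact_mod_cast (zero_lt_one.trans hq1).ne'
  have hn0 : ∀ᶠ n : ℕ in atTop, n ≠ 0 := eventually_ne_atTop 0
  split_ifs with hχ
  · subst hχ
    obtain ⟨K, hK⟩ := exists_le_coprimePrimePowerSum_add hg
    have hinv : Tendsto (fun n : ℕ => 1 - (K : ℝ) * (Nat.card F : ℝ)⁻¹ ^ n) atTop (𝓝 1) := by
      have := (tendsto_pow_atTop_nhds_zero_of_lt_one (by positivity) (inv_lt_one_of_one_lt₀ hq1)).const_mul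
        (K : ℝ)
      simpa using this.const_sub 1
    have hreal : Tendsto (fun n : ℕ => (coprimePrimePowerSum g n : ℝ) / (Nat.card F : ℝ) ^ n)
        atTop (𝓝 1) := by
      refine tendsto_of_tendsto_of_tendsto_of_le_of_le' hinv tendsto_const_nhds ?_ ?_
      · filter_upwards [hn0] with n hn
        have h1 : (Nat.card F : ℝ) ^ n ≤ coprimePrimePowerSum g n + K := by exact_mod_cast hK n hn
        have h2 : (0 : ℝ) < (Nat.card F : ℝ) ^ n := by positivity
        rw [le_div_iff₀ h2, sub_mul, mul_assoc, inv_pow, inv_mul_cancel₀ h2.ne']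
        linarith
      · filter_upwards [hn0] with n hn
        exact div_le_one_of_le₀ (by exact_mod_cast coprimePrimePowerSum_le hn) (by positivity)
    have hc := (Complex.continuous_ofReal.tendsto 1).comp hreal
    rw [Complex.ofReal_one] at hc
    refine hc.congr' ?_
    filter_upwards [hn0] with n hn
    rw [primePowerSum_modChar_one hn]
    simp
  · have hlim : Tendsto (fun n : ℕ =>
        -((lInvRoots (modChar χ) g.natDegree).map fun α => (α / (Nat.card F : ℂ)) ^ n).sum) atTop
        (𝓝 (-((lInvRoots (modChar χ) g.natDegree).map fun _ => (0 : ℂ)).sum)) := by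
      refine (tendsto_multiset_sum _ fun α hα => tendsto_pow_atTop_nhds_zero_of_norm_lt_one ?_).neg
      rw [norm_div, Complex.norm_natCast, div_lt_one (by linarith)]
      exact norm_lt_card_of_mem_lInvRoots hg hχ hα
    simp only [Multiset.map_const', Multiset.sum_replicate, smul_zero, neg_zero] at hlim
    refine hlim.congr' ?_
    filter_upwards [hn0] with n hn
    rw [primePowerSum_eq_neg_sum_lInvRoots (fun k hk => monicSum_modChar_eq_zero hg hχ hk) hn,
      neg_div, div_eq_mul_inv, ← Multiset.sum_map_mul_right]
    simp only [mul_pow, inv_pow, div_eq_mul_inv]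

theorem tendsto_progressionPrimePowerSum_div (hg : g ≠ 0) (hgh : IsCoprime g h) :
    ∃ c > (0 : ℝ), Tendsto (fun n : ℕ => (progressionPrimePowerSum g h n : ℝ) / (Nat.card F : ℝ) ^ n)
      atTop (𝓝 c) := by
  classical
  have := finite_adjoinRoot_of_ne_zero hg
  have := Fintype.ofFinite (MulChar (AdjoinRoot g) ℂ)
  have hφ : (0 : ℝ) < Fintype.card (MulChar (AdjoinRoot g) ℂ) := by
    exact_mod_cast Fintype.card_pos
  refine ⟨(Fintype.card (MulChar (AdjoinRoot g) ℂ) : ℝ)⁻¹, by positivity, ?_⟩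
  have hsum : Tendsto (fun n : ℕ => ∑ χ : MulChar (AdjoinRoot g) ℂ,
      χ⁻¹ (AdjoinRoot.mk g h) * (primePowerSum (modChar χ) n / (Nat.card F : ℂ) ^ n)) atTop
      (𝓝 (∑ χ : MulChar (AdjoinRoot g) ℂ, χ⁻¹ (AdjoinRoot.mk g h) * if χ = 1 then 1 else 0)) :=
    tendsto_finsetSum _ fun χ _ => (tendsto_primePowerSum_div hg χ).const_mul _
  simp only [mul_ite, mul_one, mul_zero, Finset.sum_ite_eq', Finset.mem_univ, if_true, inv_one,
    MulChar.one_apply (isUnit_mk_iff.mpr hgh), ← mul_div_assoc, ← Finset.sum_div,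
    ← card_mul_progressionPrimePowerSum hg hgh] at hsum
  have hre := ((Complex.continuous_re.tendsto _).comp hsum).const_mul
    (Fintype.card (MulChar (AdjoinRoot g) ℂ) : ℝ)⁻¹
  rw [Complex.one_re, mul_one] at hre
  refine hre.congr fun n => ?_
  have h1 : (Fintype.card (MulChar (AdjoinRoot g) ℂ) : ℂ) * progressionPrimePowerSum g h n /
      (Nat.card F : ℂ) ^ n = ((Fintype.card (MulChar (AdjoinRoot g) ℂ) *
        progressionPrimePowerSum g h n / (Nat.card F : ℝ) ^ n : ℝ) : ℂ) := by push_cast; rfl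
  rw [Function.comp_apply, h1, Complex.ofReal_re]
  field_simp

open Classical in
/-- The monic irreducible polynomials of degree `n` congruent to `h` modulo `g`. -/
noncomputable def progressionPrimes (g h : F[X]) (n : ℕ) : Finset F[X] :=
  {P ∈ monicPrimesLE F n | P.natDegree = n ∧ g ∣ P - h}

theorem mem_progressionPrimes {n : ℕ} {P : F[X]} : P ∈ progressionPrimes g h n ↔
    P.Monic ∧ Irreducible P ∧ P.natDegree = n ∧ g ∣ P - h := by
  classical
  rw [progressionPrimes, Finset.mem_filter, mem_monicPrimesLE]
  exact ⟨fun h => ⟨h.1.1, h.1.2.1, h.2⟩, fun h => ⟨⟨h.1, h.2.1, h.2.2.1.le⟩, h.2.2⟩⟩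

/-- Proper powers come from primes of degree `m ≤ n / 2`; those of a given degree `m` contribute at
most `q ^ m`. -/
theorem progressionPrimePowerSum_le (g h : F[X]) {n : ℕ} (hn : n ≠ 0) :
    progressionPrimePowerSum g h n ≤
      n * (progressionPrimes g h n).card + n * Nat.card F ^ (n / 2) := by
  classical
  rw [progressionPrimePowerSum, ← Finset.sum_filter_add_sum_filter_not _ (fun P => P.natDegree = n)]
  refine add_le_add ?_ ?_
  · rw [mul_comm, ← smul_eq_mul]
    refine (Finset.sum_le_card_nsmul _ _ n fun P hP => (Finset.mem_filter.mp hP).2.le).trans ?_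
    refine Nat.mul_le_mul_right n (Finset.card_le_card fun P hP => ?_)
    simp only [Finset.mem_filter, mem_monicPrimesDvd hn] at hP
    obtain ⟨⟨⟨h1, h2, -⟩, h3⟩, h4⟩ := hP
    rw [h4, Nat.div_self (Nat.pos_of_ne_zero hn), pow_one, AdjoinRoot.mk_eq_mk] at h3
    exact mem_progressionPrimes.mpr ⟨h1, h2, h4, h3⟩
  · have hmaps : ∀ P ∈ {P ∈ {P ∈ monicPrimesDvd F n | AdjoinRoot.mk g P ^ (n / P.natDegree) =
        AdjoinRoot.mk g h} | ¬ P.natDegree = n}, P.natDegree ∈ Finset.Icc 1 (n / 2) := by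
      intro P hP
      simp only [Finset.mem_filter, mem_monicPrimesDvd hn] at hP
      obtain ⟨⟨⟨-, h2, k, hk⟩, -⟩, h4⟩ := hP
      have hpos := h2.natDegree_pos
      refine Finset.mem_Icc.mpr ⟨hpos, (Nat.le_div_iff_mul_le two_pos).mpr ?_⟩
      rcases k with _ | _ | k
      · omega
      · omega
      · rw [hk]; exact Nat.mul_le_mul_left _ (by omega)
    rw [← Finset.sum_fiberwise_of_maps_to hmaps]
    have hq : 1 ≤ Nat.card F := Nat.card_pos
    refine (Finset.sum_le_card_nsmul _ _ (Nat.card F ^ (n / 2)) fun m hm => ?_).trans ?_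
    · rw [Finset.mem_Icc] at hm
      refine le_trans ?_ (Nat.pow_le_pow_right hq hm.2)
      rw [← sum_natDegree_monicPrimesDvd (by omega)]
      refine Finset.sum_le_sum_of_subset fun P hP => ?_
      simp only [Finset.mem_filter, mem_monicPrimesDvd hn] at hP
      exact (mem_monicPrimesDvd (by omega)).mpr ⟨hP.1.1.1.1, hP.1.1.1.2.1, hP.2.dvd⟩
    · rw [Nat.card_Icc, smul_eq_mul]
      exact Nat.mul_le_mul_right _ (by omega)

/-- Dirichlet's theorem for `F[X]` with control of the degree: the number of monic irreducible
polynomials of degree `n` in a reduced residue class grows faster than linearly in `n`. -/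
theorem eventually_mul_le_card_progressionPrimes (hg : g ≠ 0) (hgh : IsCoprime g h) (C : ℕ) :
    ∀ᶠ n : ℕ in atTop, C * n ≤ (progressionPrimes g h n).card := by
  obtain ⟨c, hc, hlim⟩ := tendsto_progressionPrimePowerSum_div hg hgh
  set q : ℝ := (Nat.card F : ℝ) with hq
  have hq1 : 1 < q := by rw [hq]; exact_mod_cast (Finite.one_lt_card : 1 < Nat.card F)
  have hq0 : 0 < q := zero_lt_one.trans hq1
  have hs1 : 1 < √q := by rwa [Real.lt_sqrt zero_le_one, one_pow]
  -- Relative to `q ^ n`, these are the proper prime powers and `n` times the target `C * n`.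
  have herr : Tendsto (fun n : ℕ => (n : ℝ) ^ 1 * (√q)⁻¹ ^ n + C * ((n : ℝ) ^ 2 * q⁻¹ ^ n)) atTop
      (𝓝 0) := by
    have h1 := tendsto_pow_const_mul_const_pow_of_abs_lt_one 1 (r := (√q)⁻¹)
      (by rw [abs_of_pos (by positivity)]; exact inv_lt_one_of_one_lt₀ hs1)
    have h2 := tendsto_pow_const_mul_const_pow_of_abs_lt_one 2 (r := q⁻¹)
      (by rw [abs_of_pos (by positivity)]; exact inv_lt_one_of_one_lt₀ hq1)
    simpa using h1.add (h2.const_mul (C : ℝ))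
  filter_upwards [hlim.eventually_const_lt (half_lt_self hc),
    herr.eventually_lt_const (half_pos hc), eventually_ne_atTop 0] with n h1 h2 hn
  have hqn : 0 < q ^ n := by positivity
  have hn' : (0 : ℝ) < n := by exact_mod_cast Nat.pos_of_ne_zero hn
  rw [lt_div_iff₀ hqn] at h1
  have h3 : (progressionPrimePowerSum g h n : ℝ) ≤
      n * (progressionPrimes g h n).card + n * q ^ (n / 2) := by
    rw [hq]; exact_mod_cast progressionPrimePowerSum_le g h hn
  have hsq : √q ^ n * √q ^ n = q ^ n := by rw [← mul_pow, Real.mul_self_sqrt hq0.le]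
  have h4 : q ^ (n / 2) ≤ √q ^ n := by
    conv_lhs => rw [← Real.sq_sqrt hq0.le, ← pow_mul]
    exact pow_le_pow_right₀ hs1.le (Nat.mul_div_le n 2)
  have h5 : (n : ℝ) * √q ^ n + C * n ^ 2 < c / 2 * q ^ n := by
    have := mul_lt_mul_of_pos_right h2 hqn
    have e1 : (√q)⁻¹ ^ n * q ^ n = √q ^ n := by
      rw [← hsq, inv_pow, inv_mul_cancel_left₀ (by positivity)]
    have e2 : q⁻¹ ^ n * q ^ n = 1 := by rw [inv_pow, inv_mul_cancel₀ hqn.ne']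
    linear_combination this + (-(n : ℝ)) * e1 - C * n ^ 2 * e2
  have h6 := mul_le_mul_of_nonneg_left h4 hn'.le
  have h7 : (n : ℝ) * (C * n) ≤ n * (progressionPrimes g h n).card := by nlinarith
  exact_mod_cast le_of_mul_le_mul_left h7 hn'

end Progressions

/-! ### Korselt's criterion and the construction -/

section Carmichael

variable {F : Type*} [Field F]

theorem Squarefree.dvd_of_forall_irreducible_dvd {f x : F[X]} (hf : Squarefree f)
    (h : ∀ P, Irreducible P → P ∣ f → P ∣ x) : f ∣ x := by
  classical
  rcases eq_or_ne x 0 with rfl | hx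
  · exact dvd_zero f
  have hnodup := (UniqueFactorizationMonoid.squarefree_iff_nodup_normalizedFactors hf.ne_zero).mp hf
  rw [UniqueFactorizationMonoid.dvd_iff_normalizedFactors_le_normalizedFactors hf.ne_zero hx,
    Multiset.le_iff_subset hnodup]
  intro P hP
  rw [UniqueFactorizationMonoid.mem_normalizedFactors_iff' hf.ne_zero] at hP
  rw [UniqueFactorizationMonoid.mem_normalizedFactors_iff' hx]
  exact ⟨hP.1, hP.2.1, h P hP.1 hP.2.2⟩

theorem natCard_quotient_span_singleton {f : F[X]} (hf : f ≠ 0) :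
    Nat.card (F[X] ⧸ Ideal.span {f}) = Nat.card F ^ f.natDegree := by
  have : Module.Finite F (F[X] ⧸ Ideal.span {f}) := (AdjoinRoot.powerBasis hf).finite
  rw [Module.natCard_eq_pow_finrank (K := F), finrank_quotient_span_eq_natDegree]

theorem infinite_of_forall_exists_le_natDegree {s : Set F[X]}
    (h : ∀ B, ∃ f ∈ s, B ≤ f.natDegree) : s.Infinite := by
  refine Set.Infinite.of_image natDegree (Set.infinite_of_forall_exists_gt fun B => ?_)
  obtain ⟨f, hf, hB⟩ := h (B + 1)
  exact ⟨_, Set.mem_image_of_mem _ hf, hB⟩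

theorem dvd_sub_one_of_forall_irreducible {g w : F[X]} (hw : w.Monic)
    (h : ∀ P : F[X], Irreducible P → P.Monic → P ∣ w → g ∣ P - 1) : g ∣ w - 1 := by
  classical
  have hprod : (UniqueFactorizationMonoid.normalizedFactors w).prod = w := by
    have := UniqueFactorizationMonoid.prod_normalizedFactors_eq hw.ne_zero
    rwa [hw.normalize_eq_self] at this
  rw [← AdjoinRoot.mk_eq_mk, map_one, ← hprod, map_multiset_prod]
  refine Multiset.prod_eq_one fun x hx => ?_
  obtain ⟨P, hP, rfl⟩ := Multiset.mem_map.mp hx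
  have hi := UniqueFactorizationMonoid.irreducible_of_normalized_factor P hP
  rw [← map_one (AdjoinRoot.mk g), AdjoinRoot.mk_eq_mk]
  refine h P hi ?_ (UniqueFactorizationMonoid.dvd_of_mem_normalizedFactors hP)
  rw [← UniqueFactorizationMonoid.normalize_normalized_factor P hP]
  exact monic_normalize hi.ne_zero

variable [Finite F]

theorem Irreducible.dvd_pow_card_pow_sub {P : F[X]} (hP : Irreducible P) {n : ℕ}
    (hn : P.natDegree ∣ n) (a : F[X]) : P ∣ a ^ Nat.card F ^ n - a := by
  have := Fact.mk hP
  have := finite_adjoinRoot_of_ne_zero hP.ne_zero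
  have := Fintype.ofFinite (AdjoinRoot P)
  obtain ⟨k, rfl⟩ := hn
  have hcard : Fintype.card (AdjoinRoot P) = Nat.card F ^ P.natDegree := by
    rw [← Nat.card_eq_fintype_card]; exact natCard_quotient_span_singleton hP.ne_zero
  rw [← AdjoinRoot.mk_eq_mk, map_pow, pow_mul, ← hcard, FiniteField.pow_card_pow]

/-- Korselt's criterion for polynomials over a finite field. -/
theorem isCarmichaelPolynomial_of_squarefree {f : F[X]} (hf : Squarefree f) (hu : ¬ IsUnit f)
    (hi : ¬ Irreducible f) (hd : ∀ P, Irreducible P → P ∣ f → P.natDegree ∣ f.natDegree) :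
    IsCarmichaelPolynomial f where
  finite := finite_adjoinRoot_of_ne_zero hf.ne_zero
  nontrivial := by rwa [Ideal.Quotient.nontrivial_iff, Ne, Ideal.span_singleton_eq_top]
  not_isField h := by
    have := Ideal.Quotient.maximal_of_isField _ h
    exact hi ((Ideal.span_singleton_prime hf.ne_zero).mp this.isPrime).irreducible
  pow_card a := by
    obtain ⟨a, rfl⟩ := Ideal.Quotient.mk_surjective a
    rw [natCard_quotient_span_singleton hf.ne_zero, ← map_pow, Ideal.Quotient.mk_eq_mk_iff_sub_mem,
      Ideal.mem_span_singleton]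
    exact hf.dvd_of_forall_irreducible_dvd fun P hP hPf => hP.dvd_pow_card_pow_sub (hd P hP hPf) a

theorem exists_progression_carmichael_multiple {u g h : F[X]} (hu : Squarefree u) (hg : g ≠ 0)
    (hgh : IsCoprime g h) (B : ℕ) :
    ∃ w : F[X], Squarefree w ∧ w.Monic ∧
      (∀ P : F[X], Irreducible P → P.Monic → P ∣ w → g ∣ P - h) ∧
      IsCarmichaelPolynomial (u * w) ∧ B ≤ w.natDegree := by
  classical
  obtain ⟨d, hd⟩ : ∃ d, u.natDegree = d := ⟨_, rfl⟩
  -- `d!` absorbs the degrees of the factors of `u`; the extra 2 makes `deg (u * w)` exceed `a + 1`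
  -- even for `a = 1`, so `u * w` cannot be a single prime.
  obtain ⟨M, hM⟩ : ∃ M, 2 * d.factorial = M + 1 :=
    ⟨2 * d.factorial - 1, by have := d.factorial_pos; omega⟩
  have hA := eventually_mul_le_card_progressionPrimes hg hgh (2 * (M + 1))
  obtain ⟨a, ha1, ha2, ha⟩ := (hA.and (((Filter.tendsto_add_atTop_nat 1).eventually hA).and
    (Filter.eventually_ge_atTop (d + B + 1)))).exists
  obtain ⟨e, rfl⟩ : ∃ e, a = d + e := ⟨a - d, by omega⟩
  set a := d + e with hae
  -- The sizes are forced by `d + ((a + 1) M + d) a + e (a + 1) = a (a + 1) (M + 1)`, where `a = d +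
  -- e`. They are linear in `a`, hence available.
  obtain ⟨S, hS, hScard⟩ := Finset.exists_subset_card_eq
    (show (a + 1) * M + d ≤ (progressionPrimes g h a).card from le_trans (by nlinarith) ha1)
  obtain ⟨T, hT, hTcard⟩ := Finset.exists_subset_card_eq
    (show e ≤ (progressionPrimes g h (a + 1)).card from le_trans (by nlinarith) ha2)
  have hS' := fun P (hP : P ∈ S) => mem_progressionPrimes.mp (hS hP)
  have hT' := fun P (hP : P ∈ T) => mem_progressionPrimes.mp (hT hP)
  have hST : Disjoint S T := Finset.disjoint_left.mpr fun P h1 h2 => by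
    have := (hS' P h1).2.2.1
    have := (hT' P h2).2.2.1
    omega
  have hW : ∀ P ∈ S ∪ T, P.Monic ∧ Irreducible P ∧ (P.natDegree = a ∨ P.natDegree = a + 1) ∧
      g ∣ P - h := by
    intro P hP
    rcases Finset.mem_union.mp hP with hP | hP
    · obtain ⟨h1, h2, h3, h4⟩ := hS' P hP
      exact ⟨h1, h2, Or.inl h3, h4⟩
    · obtain ⟨h1, h2, h3, h4⟩ := hT' P hP
      exact ⟨h1, h2, Or.inr h3, h4⟩
  set w := ∏ P ∈ S ∪ T, P with hw
  have hwm : w.Monic := monic_prod_of_monic _ _ fun P hP => (hW P hP).1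
  have hwdeg : w.natDegree = ((a + 1) * M + d) * a + e * (a + 1) := by
    rw [hw, natDegree_prod_of_monic _ _ fun P hP => (hW P hP).1, Finset.sum_union hST,
      Finset.sum_congr rfl fun P hP => (hS' P hP).2.2.1,
      Finset.sum_congr rfl fun P hP => (hT' P hP).2.2.1, Finset.sum_const, Finset.sum_const,
      hScard, hTcard, smul_eq_mul, smul_eq_mul]
  have huw : (u * w).natDegree = a * (a + 1) * (M + 1) := by
    rw [natDegree_mul hu.ne_zero hwm.ne_zero, hwdeg, hd, hae]; ring
  have hcop : ∀ P ∈ S ∪ T, ∀ Q ∈ S ∪ T, P ≠ Q → IsCoprime P Q := by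
    intro P hP Q hQ hPQ
    refine (Irreducible.coprime_iff_not_dvd (hW P hP).2.1).mpr fun hdvd => hPQ ?_
    exact eq_of_monic_of_associated (hW P hP).1 (hW Q hQ).1
      ((hW P hP).2.1.associated_of_dvd (hW Q hQ).2.1 hdvd)
  have hwsq : Squarefree w := Finset.squarefree_prod_of_pairwise_isCoprime
    (fun P hP Q hQ hPQ => (hcop P hP Q hQ hPQ).isRelPrime) fun P hP => (hW P hP).2.1.squarefree
  have hfac : ∀ P, Irreducible P → P ∣ w → ∃ Q ∈ S ∪ T, Associated P Q := by
    intro P hP hPw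
    obtain ⟨Q, hQ, hPQ⟩ := (hP.prime.dvd_finsetProd_iff _).mp hPw
    exact ⟨Q, hQ, hP.associated_of_dvd (hW Q hQ).2.1 hPQ⟩
  -- The primes in `w` have degree at least `a > d`, too large to divide `u`.
  have hucop : IsCoprime u w := by
    refine IsCoprime.prod_right fun P hP => ?_
    refine ((Irreducible.coprime_iff_not_dvd (hW P hP).2.1).mpr fun hdvd => ?_).symm
    have := natDegree_le_of_dvd hdvd hu.ne_zero
    rcases (hW P hP).2.2.1 with h' | h' <;> omega
  have hBw : a < w.natDegree := by
    rw [hwdeg]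
    have := d.factorial_pos
    nlinarith [Nat.zero_le (a * M * (a + 1))]
  refine ⟨w, hwsq, hwm, ?_, ?_, by omega⟩
  · intro P hP hPm hPw
    obtain ⟨Q, hQ, hPQ⟩ := hfac P hP hPw
    rw [eq_of_monic_of_associated hPm (hW Q hQ).1 hPQ]
    exact (hW Q hQ).2.2.2
  · refine isCarmichaelPolynomial_of_squarefree
      (squarefree_mul_iff.mpr ⟨hucop.isRelPrime, hu, hwsq⟩) ?_ ?_ ?_
    · intro hunit
      have := natDegree_eq_zero_of_isUnit (isUnit_of_mul_isUnit_right hunit)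
      omega
    · intro hirr
      have hwu : ¬ IsUnit w := fun h' => by have := natDegree_eq_zero_of_isUnit h'; omega
      obtain ⟨P, hP, hPw⟩ := WfDvdMonoid.exists_irreducible_factor hwu hwm.ne_zero
      obtain ⟨Q, hQ, hPQ⟩ := hfac P hP hPw
      have h1 : (u * w).natDegree = Q.natDegree := natDegree_eq_of_degree_eq
        (degree_eq_degree_of_associated
          ((hP.associated_of_dvd hirr (hPw.mul_left u)).symm.trans hPQ))
      have h2 : w.natDegree ≤ (u * w).natDegree :=
        natDegree_le_of_dvd (dvd_mul_left w u) (mul_ne_zero hu.ne_zero hwm.ne_zero)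
      have := d.factorial_pos
      have h3 : a * (a + 1) * 2 ≤ (u * w).natDegree := by
        rw [huw]; exact Nat.mul_le_mul_left _ (by omega)
      rcases (hW Q hQ).2.2.1 with h' | h' <;> nlinarith
    · intro P hP hPuw
      rw [huw]
      rcases hP.prime.dvd_or_dvd hPuw with hPu | hPw
      · have hle := natDegree_le_of_dvd hPu hu.ne_zero
        rw [hd] at hle
        rw [← hM]
        exact ((Nat.dvd_factorial hP.natDegree_pos hle).mul_left 2).mul_left _
      · obtain ⟨Q, hQ, hPQ⟩ := hfac P hP hPw
        rw [natDegree_eq_of_degree_eq (degree_eq_degree_of_associated hPQ)]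
        rcases (hW Q hQ).2.2.1 with h' | h' <;> rw [h']
        · exact (dvd_mul_right _ _).mul_right _
        · exact (dvd_mul_left _ _).mul_right _

-- With `g = D g'` and `h = D h'`, the congruence for `D P w` reduces to `P w ≡ h'` modulo `g'`, so
-- `P` carries the class `h'` and `w` the class 1.
open Classical in
theorem exists_carmichael_in_progression {g h : F[X]} (hg : g ≠ 0)
    (hsq : Squarefree (EuclideanDomain.gcd g h)) (B : ℕ) :
    ∃ f : F[X], (f.Monic ∧ IsCarmichaelPolynomial f ∧ g ∣ f - h) ∧ B ≤ f.natDegree := by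
  set D := normalize (EuclideanDomain.gcd g h) with hD
  have hass : Associated D (EuclideanDomain.gcd g h) := normalize_associated _
  have hDsq : Squarefree D := hass.squarefree_iff.mpr hsq
  have hDm : D.Monic := monic_normalize hsq.ne_zero
  obtain ⟨g', hg'⟩ := hass.dvd.trans (EuclideanDomain.gcd_dvd_left g h)
  obtain ⟨h', hh'⟩ := hass.dvd.trans (EuclideanDomain.gcd_dvd_right g h)
  have hg'0 : g' ≠ 0 := by rintro rfl; exact hg (by rw [hg', mul_zero])
  have hcop : IsCoprime g' h' := by
    obtain ⟨k, hk⟩ := hass.symm.dvd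
    refine ⟨EuclideanDomain.gcdA g h * k, EuclideanDomain.gcdB g h * k,
      mul_left_cancel₀ hDm.ne_zero ?_⟩
    have hbez := EuclideanDomain.gcd_eq_gcd_ab g h
    conv_rhs => rw [mul_one, hk, hbez]
    linear_combination (-(EuclideanDomain.gcdA g h * k)) * hg' - EuclideanDomain.gcdB g h * k * hh'
  obtain ⟨n, hn1, hn2⟩ := ((eventually_mul_le_card_progressionPrimes hg'0 hcop 1).and
    (Filter.eventually_gt_atTop D.natDegree)).exists
  obtain ⟨P, hP⟩ := Finset.card_pos.mp (show 0 < (progressionPrimes g' h' n).card by omega)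
  obtain ⟨hPm, hPi, hPn, hPh⟩ := mem_progressionPrimes.mp hP
  -- Taking `deg P > deg D` keeps `D * P` square-free.
  have hPD : IsCoprime D P := ((Irreducible.coprime_iff_not_dvd hPi).mpr fun hdvd => by
    have := natDegree_le_of_dvd hdvd hDm.ne_zero
    omega).symm
  obtain ⟨w, -, hwm, hwP, hwC, hwB⟩ := exists_progression_carmichael_multiple
    (squarefree_mul_iff.mpr ⟨hPD.isRelPrime, hDsq, hPi.squarefree⟩) hg'0
    (isCoprime_one_right (x := g')) B
  refine ⟨D * P * w, ⟨(hDm.mul hPm).mul hwm, hwC, ?_⟩, hwB.trans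
    (natDegree_le_of_dvd (dvd_mul_left _ _) ((hDm.mul hPm).mul hwm).ne_zero)⟩
  rw [hg', hh', mul_assoc, ← mul_sub]
  refine mul_dvd_mul_left D ?_
  have : P * w - h' = P * (w - 1) + (P - h') := by ring
  rw [this]
  exact dvd_add ((dvd_sub_one_of_forall_irreducible hwm hwP).mul_left P) hPh

end Carmichael

open Classical in
theorem theorem4p2 {F : Type*} [Field F] [Finite F] :
    (∀ u g h : F[X], Squarefree u → g ≠ 0 → IsCoprime g h →
      {w : F[X] | Squarefree w ∧ w.Monic ∧
        (∀ P : F[X], Irreducible P → P.Monic → P ∣ w → g ∣ P - h) ∧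
        IsCarmichaelPolynomial (u * w)}.Infinite) ∧
    (∀ g h : F[X], g ≠ 0 → (IsCoprime g h ∨ Squarefree (EuclideanDomain.gcd g h)) →
      {f : F[X] | f.Monic ∧ IsCarmichaelPolynomial f ∧ g ∣ f - h}.Infinite) := by
  refine ⟨fun u g h hu hg hgh => infinite_of_forall_exists_le_natDegree fun B => ?_,
    fun g h hg hgh => infinite_of_forall_exists_le_natDegree fun B => ?_⟩
  · obtain ⟨w, h1, h2, h3, h4, h5⟩ := exists_progression_carmichael_multiple hu hg hgh B
    exact ⟨w, ⟨h1, h2, h3, h4⟩, h5⟩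
  · obtain ⟨f, hf, hB⟩ := exists_carmichael_in_progression hg
      (hgh.elim (fun h' => (EuclideanDomain.gcd_isUnit_iff.mpr h').squarefree) id) B
    exact ⟨f, hf, hB⟩
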